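/- Let $p$ be a prime. Call two polynomials over $\mathbb F_p=\mathbb Z/p$ similar if one can be transformed into the other by a finite combination of the following transformations and their inverses: $f(x)\mapsto f(cx)$ and $f(x)\mapsto c f(x)$ for an integer $1<c<p$; $f(x)\mapsto x^c f(x)$ for an integer $c>0$; $f(x)\mapsto f(x^c)$ for an integer $c>1$; $f(x)\mapsto x^{\deg f}f(x^{-1})$; and $f(x)\mapsto f(x)^c$ for an integer $c>1$. For a polynomial $f\in\mathbb F_p[x]$ of degree $d\ge 1$, let $X_f$ be the set of the $p^d-1$ nonzero blocks $h=(h_0,\dots,h_{d-1})\in\mathbb F_p^d$, and write $h(x)=\sum_{s<d}h_sx^s$. For $0\le i,j<p$ let $T_{j,i}(h)\in\mathbb F_p^d$ be the block of the coefficients of $x^{jd},x^{jd+1},\dots,x^{jd+d-1}$ in $x^i f(x)^j h(x^p)$. (If $h$ is the block of coefficients of $f^k$ at positions $n,\dots,n+d-1$, then $T_{j,i}(h)$ is the block of coefficients of $f^{pk+j}$ at the $d$ positions starting with $pn+jd-i$.) Let $B=B(f)$ be Willson's matrix, the nonnegative integer matrix indexed by $X_f$ with entries $$B_{h',h}=\#\{(j,i):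 0\le i,j<p,\ T_{j,i}(h)=h'\},$$ and let the Perron–Frobenius eigenvalue $\lambda(f)$ be the largest positive eigenvalue of $B(f)$. Theorem. If $f,g\in\mathbb F_p[x]$ are nonconstant and similar, then $\lambda(f)$ and $\lambda(g)$ exist and $\lambda(f)=\lambda(g)$. -/

import Mathlib

open Polynomial

/-- Elementary transformations of polynomials over `ℤ/p`: `f(cx)` and `c f(x)` with `1 < c < p`,
`x^c f(x)` with `c > 0`, `f(x^c)` with `c > 1`, `x^(deg f) f(x⁻¹)`, and `f(x)^c` with `c > 1`. -/
inductive SimilarStep (p : ℕ) : (ZMod p)[X] → (ZMod p)[X] → Prop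
  | scaleVar (f : (ZMod p)[X]) (c : ℕ) (h1 : 1 < c) (hp : c < p) :
      SimilarStep p f (f.comp (C (c : ZMod p) * X))
  | scale (f : (ZMod p)[X]) (c : ℕ) (h1 : 1 < c) (hp : c < p) :
      SimilarStep p f (C (c : ZMod p) * f)
  | shift (f : (ZMod p)[X]) (c : ℕ) (h0 : 0 < c) : SimilarStep p f (X ^ c * f)
  | powVar (f : (ZMod p)[X]) (c : ℕ) (h1 : 1 < c) : SimilarStep p f (f.comp (X ^ c))
  | flip (f : (ZMod p)[X]) : SimilarStep p f f.reverse
  | pow (f : (ZMod p)[X]) (c : ℕ) (h1 : 1 < c) : SimilarStep p f (f ^ c)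

/-- Similarity of polynomials: the equivalence relation generated by the elementary
transformations. In particular it holds whenever `g` is obtained from `f`, or `f` from `g`,
by finitely many of them. -/
def SimilarPoly (p : ℕ) (f g : (ZMod p)[X]) : Prop :=
  Relation.EqvGen (SimilarStep p) f g

/-- Nonzero blocks of length `d` over `ℤ/p`, i.e. the nonzero elements of `(ℤ/p)[x]/(x^d)`. -/
abbrev Block (p d : ℕ) : Type := {h : Fin d → ZMod p // h ≠ 0}

/-- The polynomial `h₀ + h₁ x + ⋯ + h_{d-1} x^(d-1)` of a block. -/
noncomputable def blockPoly {p d : ℕ} (h : Fin d → ZMod p) : (ZMod p)[X] :=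
  ∑ s : Fin d, C (h s) * X ^ (s : ℕ)

/-- With `d = deg f`: the block of length `d` formed by the coefficients of
`x^(jd), …, x^(jd+d-1)` in `x^i f(x)^j h(x^p)`.

If `h` is the block of coefficients of `f^k` at the positions `n, …, n+d-1`, then, for
`0 ≤ i, j < p`, this is the block of coefficients of `f^(pk+j) = f^j f^k(x^p)` at the `d` positions
starting with `pn + jd - i`. For `j = 0` the map is `h(x) ↦ x^i h(x^p)` modulo `x^d`. -/
noncomputable def blockMap {p : ℕ} (f : (ZMod p)[X]) (j i : ℕ) (h : Fin f.natDegree → ZMod p) :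
    Fin f.natDegree → ZMod p :=
  fun s => (X ^ i * f ^ j * (blockPoly h).comp (X ^ p)).coeff (j * f.natDegree + s)

/-- Willson's matrix `B` of `f`, of size `p^d - 1` with `d = deg f`: the sum of the matrices of the
`p²` block maps on the nonzero blocks of length `d`. The column of `h` counts the images of `h`. -/
noncomputable def willsonMatrix {p : ℕ} (f : (ZMod p)[X]) :
    Matrix (Block p f.natDegree) (Block p f.natDegree) ℕ :=
  fun h' h => ∑ j : Fin p, ∑ i : Fin p, if blockMap f j i h.1 = h'.1 then 1 else 0

/-- `t` is the Perron–Frobenius eigenvalue `λ(f)`: the largest positive eigenvalue of `B`. -/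
def IsPerronFrobeniusEigenvalue {p : ℕ} [Fact p.Prime] (f : (ZMod p)[X]) (t : ℝ) : Prop :=
  IsGreatest {s : ℝ | 0 < s ∧ Module.End.HasEigenvalue
    (Matrix.toLin' ((willsonMatrix f).map (Nat.cast : ℕ → ℝ))) s} t

/-!
The eigenvalue `λ(f)` measures how fast the number of nonzero coefficients of the powers of `f`
grows, and similar polynomials have growth of the same order.

Let `N_k(f)` be the total number of nonzero coefficients of `f ^ 0, …, f ^ (p ^ k - 1)`
(`powSupportCount`). Since `f ^ (p ^ k) = f(x ^ (p ^ k))`, a word of length `k` in the block maps is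
again a block map with `q = p ^ k` in place of `p` (`iteratedBlockMap_comp`), so the column sums of
`B ^ k` count the words that do not annihilate a given block (`sum_willsonMatrix_pow`). Applied to
the unit blocks, these words read off all windows of length `d` of the powers `f ^ j`, `j < p ^ k`,
that contain a nonzero coefficient. Hence the sum of the entries of `B ^ k` agrees with `N_k(f)` up to
constant factors.

For a nonnegative matrix `A`, if the sum of the entries of `A ^ k` is at least `c r ^ k` for all
`k`, then `A` has a real eigenvalue `≥ r` (`exists_eigenvalue_ge_of_growth`). Otherwise the
resolvent `(t - A)⁻¹` would exist for all `t ≥ r`; it would be nonnegative (`resolvent_nonneg`), and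
so would bound the partial sums of the divergent series `∑ A ^ k / r ^ (k + 1)`. It follows that the
largest positive eigenvalue of `B` exists and depends only on the order of growth of `N_k(f)`.

All elementary transformations but `f ↦ f ^ c` leave the number of nonzero coefficients of every
power unchanged. For `f ^ c`, the two bounds come from `#supp(P Q) ≤ #supp P · #supp Q`, applied to
`f ^ (c i + r)` and, with the Frobenius identity, to `f ^ (p ^ k i + r)`. The comparison of `N_k`
makes sense for constant polynomials too, which matters because the flip of a monomial is constant.
-/

/-! ### Nonnegative matrices: growth of powers and real eigenvalues -/

section NonnegativeMatrices

variable {ι : Type*} [Fintype ι]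

lemma matrix_mul_nonneg {A B : Matrix ι ι ℝ} (hA : ∀ i j, 0 ≤ A i j) (hB : ∀ i j, 0 ≤ B i j)
    (i j : ι) : 0 ≤ (A * B) i j :=
  Finset.sum_nonneg fun k _ => mul_nonneg (hA i k) (hB k j)

variable [DecidableEq ι]

lemma matrix_pow_nonneg {A : Matrix ι ι ℝ} (hA : ∀ i j, 0 ≤ A i j) (k : ℕ) :
    ∀ i j, 0 ≤ (A ^ k) i j := by
  induction k with
  | zero =>
    intro i j
    rw [pow_zero, Matrix.one_apply]
    split_ifs <;> norm_num
  | succ k ih =>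
    rw [pow_succ]
    exact matrix_mul_nonneg ih hA

lemma matrix_map_natCast_pow (A : Matrix ι ι ℕ) (k : ℕ) :
    A.map (Nat.cast : ℕ → ℝ) ^ k = (A ^ k).map (Nat.cast : ℕ → ℝ) :=
  (map_pow (Nat.castRingHom ℝ).mapMatrix A k).symm

/-- The Neumann series: for a nonnegative matrix `M` and small `s ≥ 0`, the matrix `1 - s M` has a
nonnegative inverse. -/
lemma exists_nonneg_inverse_one_sub_smul {M : Matrix ι ι ℝ} (hM : ∀ i j, 0 ≤ M i j) :
    ∃ δ : ℝ, 0 < δ ∧ ∀ s : ℝ, 0 ≤ s → s < δ →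
      ∃ N : Matrix ι ι ℝ, (∀ i j, 0 ≤ N i j) ∧ N * (1 - s • M) = 1 := by
  let _ : NormedRing (Matrix ι ι ℝ) := Matrix.linftyOpNormedRing
  let _ : NormedAlgebra ℝ (Matrix ι ι ℝ) := Matrix.linftyOpNormedAlgebra
  have _ : CompleteSpace (Matrix ι ι ℝ) := FiniteDimensional.complete ℝ _
  refine ⟨(‖M‖ + 1)⁻¹, by positivity, fun s hs hsδ => ⟨∑' k : ℕ, (s • M) ^ k, ?_, ?_⟩⟩
  all_goals
    have hnorm : ‖s • M‖ < 1 := by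
      rw [norm_smul, Real.norm_of_nonneg hs]
      calc s * ‖M‖ ≤ s * (‖M‖ + 1) := by gcongr; linarith
        _ < (‖M‖ + 1)⁻¹ * (‖M‖ + 1) := by gcongr
        _ = 1 := inv_mul_cancel₀ (by positivity)
  · intro i j
    have hsum : HasSum (fun k : ℕ => (s • M) ^ k) (∑' k : ℕ, (s • M) ^ k) :=
      (summable_geometric_of_norm_lt_one hnorm).hasSum
    have hcont : Continuous fun N : Matrix ι ι ℝ => N i j :=
      LinearMap.continuous_of_finiteDimensional (Matrix.entryLinearMap ℝ ℝ i j)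
    refine ge_of_tendsto ((hcont.tendsto _).comp hsum) (Filter.Eventually.of_forall fun F => ?_)
    simp only [Function.comp, Matrix.sum_apply]
    exact Finset.sum_nonneg fun k _ =>
      matrix_pow_nonneg (fun a b => mul_nonneg hs (hM a b)) k i j
  · exact geom_series_mul_neg _ hnorm

lemma hasEigenvalue_of_det_eq_zero {A : Matrix ι ι ℝ} {s : ℝ}
    (h : (s • (1 : Matrix ι ι ℝ) - A).det = 0) :
    Module.End.HasEigenvalue (Matrix.toLin' A) s := by
  obtain ⟨v, hv, hAv⟩ := Matrix.exists_mulVec_eq_zero_iff.mpr h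
  refine Module.End.hasEigenvalue_of_hasEigenvector (x := v) ⟨?_, hv⟩
  rw [Module.End.mem_eigenspace_iff, Matrix.toLin'_apply]
  rw [Matrix.sub_mulVec, Matrix.smul_mulVec, Matrix.one_mulVec] at hAv
  exact (sub_eq_zero.mp hAv).symm

/-- If all real eigenvalues of a nonnegative matrix `A` are smaller than `r`, then the resolvent
`(r - A)⁻¹` is nonnegative. It is so for large `t` in place of `r`; the set of such `t ≥ r` is
closed, and by the Neumann series its least element can only be `r`. -/
lemma resolvent_nonneg {A : Matrix ι ι ℝ} (hA : ∀ i j, 0 ≤ A i j) {r : ℝ} (hr : 0 < r)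
    (hdet : ∀ t, r ≤ t → (t • (1 : Matrix ι ι ℝ) - A).det ≠ 0) :
    ∀ i j, 0 ≤ (r • (1 : Matrix ι ι ℝ) - A)⁻¹ i j := by
  have hunit : ∀ t, r ≤ t → IsUnit (t • (1 : Matrix ι ι ℝ) - A).det :=
    fun t ht => isUnit_iff_ne_zero.mpr (hdet t ht)
  set R : ℝ → Matrix ι ι ℝ := fun t => (t • (1 : Matrix ι ι ℝ) - A)⁻¹ with hR
  set S : Set ℝ := {t | r ≤ t ∧ ∀ i j, 0 ≤ R t i j} with hS
  have hcont : ∀ i j, ContinuousOn (fun t => R t i j) (Set.Ici r) := by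
    intro i j
    have hlin : Continuous fun t : ℝ => t • (1 : Matrix ι ι ℝ) - A := by fun_prop
    have heq : (fun t => R t i j) = fun t => ((t • (1 : Matrix ι ι ℝ) - A).det)⁻¹ *
        (t • (1 : Matrix ι ι ℝ) - A).adjugate i j := by
      funext t
      simp only [hR, Matrix.inv_def, Matrix.smul_apply, smul_eq_mul, Ring.inverse_eq_inv']
    rw [heq]
    exact (hlin.matrix_det.continuousOn.inv₀ fun t ht => hdet t ht).mul
      (hlin.matrix_adjugate.matrix_elem i j).continuousOn
  have hclosed : IsClosed S := by
    have hSeq : S = Set.Ici r ∩ ⋂ i, ⋂ j, Set.Ici r ∩ (fun t => R t i j) ⁻¹' Set.Ici 0 := by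
      ext t
      simp only [hS, Set.mem_ofPred_eq, Set.mem_inter_iff, Set.mem_iInter, Set.mem_preimage,
        Set.mem_Ici]
      exact ⟨fun h => ⟨h.1, fun i j => ⟨h.1, h.2 i j⟩⟩, fun h => ⟨h.1, fun i j => (h.2 i j).2⟩⟩
    rw [hSeq]
    exact isClosed_Ici.inter (isClosed_iInter fun i => isClosed_iInter fun j =>
      (hcont i j).preimage_isClosed_of_isClosed isClosed_Ici isClosed_Ici)
  have hbdd : BddBelow S := ⟨r, fun t ht => ht.1⟩
  have hne : S.Nonempty := by
    obtain ⟨δ, hδ, hN⟩ := exists_nonneg_inverse_one_sub_smul hA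
    have ht : 0 < max r (2 / δ) := lt_max_of_lt_left hr
    obtain ⟨N, hN0, hN1⟩ := hN (max r (2 / δ))⁻¹ (by positivity) (by
      refine lt_of_le_of_lt (inv_anti₀ (by positivity) (le_max_right _ _)) ?_
      rw [inv_div]
      linarith)
    refine ⟨max r (2 / δ), le_max_left _ _, ?_⟩
    have : R (max r (2 / δ)) = (max r (2 / δ))⁻¹ • N := by
      refine Matrix.inv_eq_left_inv ?_
      rw [Matrix.smul_mul, ← Matrix.mul_smul, smul_sub, smul_smul, inv_mul_cancel₀ ht.ne',
        one_smul, hN1]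
    rw [this]
    exact fun i j => mul_nonneg (by positivity) (hN0 i j)
  have hmem : sInf S ∈ S := hclosed.csInf_mem hne hbdd
  rcases hmem.1.eq_or_lt with heq | hlt
  · rw [← heq] at hmem
    exact hmem.2
  · exfalso
    obtain ⟨δ, hδ, hN⟩ := exists_nonneg_inverse_one_sub_smul hmem.2
    set t₀ := sInf S with ht₀
    set t := max r (t₀ - δ / 2) with ht
    have htlt : t < t₀ := max_lt hlt (by linarith)
    have htge : t₀ - δ / 2 ≤ t := le_max_right _ _
    obtain ⟨N, hN0, hN1⟩ := hN (t₀ - t) (by linarith) (by linarith)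
    have hRt : R t = N * R t₀ := by
      refine Matrix.inv_eq_left_inv ?_
      have h1 : R t₀ * (t₀ • (1 : Matrix ι ι ℝ) - A) = 1 :=
        Matrix.nonsing_inv_mul _ (hunit t₀ hmem.1)
      have h2 : t • (1 : Matrix ι ι ℝ) - A =
          (t₀ • (1 : Matrix ι ι ℝ) - A) - (t₀ - t) • (1 : Matrix ι ι ℝ) := by
        rw [sub_smul]; abel
      rw [Matrix.mul_assoc, h2, Matrix.mul_sub, h1, Matrix.mul_smul, Matrix.mul_one, hN1]
    have htS : t ∈ S := ⟨le_max_left _ _, by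
      rw [hRt]; exact matrix_mul_nonneg hN0 hmem.2⟩
    exact absurd (csInf_le hbdd htS) (not_le.mpr htlt)

/-- A nonnegative matrix whose powers grow at least like `r ^ k` has a real eigenvalue `≥ r`. -/
theorem exists_eigenvalue_ge_of_growth {A : Matrix ι ι ℝ} (hA : ∀ i j, 0 ≤ A i j) {r c : ℝ}
    (hr : 0 < r) (hc : 0 < c) (hgrow : ∀ k : ℕ, c * r ^ k ≤ ∑ i, ∑ j, (A ^ k) i j) :
    ∃ s, r ≤ s ∧ Module.End.HasEigenvalue (Matrix.toLin' A) s := by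
  by_contra! hno
  have hdet : ∀ t, r ≤ t → (t • (1 : Matrix ι ι ℝ) - A).det ≠ 0 :=
    fun t ht h => hno t ht (hasEigenvalue_of_det_eq_zero h)
  have hR0 := resolvent_nonneg hA hr hdet
  set R := (r • (1 : Matrix ι ι ℝ) - A)⁻¹ with hR
  have hstep : R = r⁻¹ • (1 + A * R) := by
    have h1 : (r • (1 : Matrix ι ι ℝ) - A) * R = 1 :=
      Matrix.mul_nonsing_inv _ (isUnit_iff_ne_zero.mpr (hdet r le_rfl))
    rw [Matrix.sub_mul, Matrix.smul_mul, Matrix.one_mul] at h1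
    rw [← h1, sub_add_cancel, smul_smul, inv_mul_cancel₀ hr.ne', one_smul]
  -- The partial sums of the series `∑ A ^ k / r ^ (k + 1)` are bounded by the resolvent.
  have hpart : ∀ n : ℕ, R = ∑ k ∈ Finset.range n, (r⁻¹) ^ (k + 1) • A ^ k
      + (r⁻¹) ^ n • (A ^ n * R) := by
    intro n
    induction n with
    | zero => simp
    | succ n ih =>
      have : (r⁻¹) ^ n • (A ^ n * R) =
          (r⁻¹) ^ (n + 1) • A ^ n + (r⁻¹) ^ (n + 1) • (A ^ (n + 1) * R) := by
        conv_lhs => rw [hstep]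
        rw [Matrix.mul_smul, smul_smul, ← pow_succ, Matrix.mul_add, Matrix.mul_one,
          ← Matrix.mul_assoc, ← pow_succ, smul_add]
      rw [Finset.sum_range_succ, add_assoc, ← this]
      exact ih
  have hbound : ∀ n : ℕ, n * (c * r⁻¹) ≤ ∑ i, ∑ j, R i j := by
    intro n
    have hentry : ∀ i j, ∑ k ∈ Finset.range n, (r⁻¹) ^ (k + 1) * (A ^ k) i j ≤ R i j := by
      intro i j
      have h := congrFun (congrFun (hpart n) i) j
      simp only [Matrix.add_apply, Matrix.sum_apply, Matrix.smul_apply, smul_eq_mul] at h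
      have h0 : 0 ≤ (r⁻¹) ^ n * (A ^ n * R) i j :=
        mul_nonneg (by positivity) (matrix_mul_nonneg (matrix_pow_nonneg hA n) hR0 i j)
      linarith
    calc (n : ℝ) * (c * r⁻¹) = ∑ k ∈ Finset.range n, c * r⁻¹ := by
          rw [Finset.sum_const, Finset.card_range, nsmul_eq_mul]
      _ ≤ ∑ k ∈ Finset.range n, (r⁻¹) ^ (k + 1) * ∑ i, ∑ j, (A ^ k) i j := by
          refine Finset.sum_le_sum fun k _ => ?_
          have h := mul_le_mul_of_nonneg_left (hgrow k) (by positivity : 0 ≤ (r⁻¹) ^ (k + 1))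
          refine le_trans (le_of_eq ?_) h
          rw [pow_succ, inv_pow]
          field_simp
      _ = ∑ i, ∑ j, ∑ k ∈ Finset.range n, (r⁻¹) ^ (k + 1) * (A ^ k) i j := by
          simp only [Finset.mul_sum]
          rw [Finset.sum_comm]
          exact Finset.sum_congr rfl fun i _ => Finset.sum_comm
      _ ≤ ∑ i, ∑ j, R i j :=
          Finset.sum_le_sum fun i _ => Finset.sum_le_sum fun j _ => hentry i j
  obtain ⟨n, hn⟩ := exists_nat_gt ((∑ i, ∑ j, R i j) / (c * r⁻¹))
  rw [div_lt_iff₀ (by positivity)] at hn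
  exact absurd (hbound n) (not_le.mpr hn)

lemma pow_le_growth_of_hasEigenvalue {A : Matrix ι ι ℝ} (hA : ∀ i j, 0 ≤ A i j) {r : ℝ}
    (hr : 0 < r) (h : Module.End.HasEigenvalue (Matrix.toLin' A) r) :
    ∃ c : ℝ, 0 < c ∧ ∀ k : ℕ, c * r ^ k ≤ ∑ i, ∑ j, (A ^ k) i j := by
  obtain ⟨x, hx, hx0⟩ := h.exists_hasEigenvector
  rw [Module.End.mem_eigenspace_iff, Matrix.toLin'_apply] at hx
  have hpow : ∀ k : ℕ, (A ^ k).mulVec x = r ^ k • x := by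
    intro k
    induction k with
    | zero => simp
    | succ k ih =>
      rw [pow_succ, ← Matrix.mulVec_mulVec, hx, Matrix.mulVec_smul, ih, smul_smul, pow_succ,
        mul_comm]
  obtain ⟨i, hi⟩ := Function.ne_iff.mp hx0
  have hi' : 0 < |x i| := abs_pos.mpr hi
  have hX : 0 < ∑ j, |x j| :=
    lt_of_lt_of_le hi' (Finset.single_le_sum (fun j _ => abs_nonneg (x j)) (Finset.mem_univ i))
  refine ⟨|x i| / ∑ j, |x j|, by positivity, fun k => ?_⟩
  rw [div_mul_eq_mul_div, div_le_iff₀ hX]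
  have hnn := matrix_pow_nonneg hA k
  calc |x i| * r ^ k = |∑ j, (A ^ k) i j * x j| := by
        have := congrFun (hpow k) i
        simp only [Matrix.mulVec, dotProduct, Pi.smul_apply, smul_eq_mul] at this
        rw [this, abs_mul, abs_of_pos (pow_pos hr k), mul_comm]
    _ ≤ ∑ j, (A ^ k) i j * |x j| := by
        refine (Finset.abs_sum_le_sum_abs _ _).trans (le_of_eq ?_)
        exact Finset.sum_congr rfl fun j _ => by rw [abs_mul, abs_of_nonneg (hnn i j)]
    _ ≤ ∑ j, (∑ i, ∑ j, (A ^ k) i j) * |x j| := by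
        refine Finset.sum_le_sum fun j _ => mul_le_mul_of_nonneg_right ?_ (abs_nonneg _)
        exact (Finset.single_le_sum (fun j _ => hnn i j) (Finset.mem_univ j)).trans
          (Finset.single_le_sum (f := fun i => ∑ j, (A ^ k) i j)
            (fun i _ => Finset.sum_nonneg fun j _ => hnn i j) (Finset.mem_univ i))
    _ = (∑ i, ∑ j, (A ^ k) i j) * ∑ j, |x j| := (Finset.mul_sum _ _ _).symm

/-- If the entries of every power of a nonnegative matrix sum to at least `1`, then the matrix has a
largest positive eigenvalue. -/
theorem exists_isGreatest_pos_eigenvalue {A : Matrix ι ι ℝ} (hA : ∀ i j, 0 ≤ A i j)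
    (hgrow : ∀ k : ℕ, 1 ≤ ∑ i, ∑ j, (A ^ k) i j) :
    ∃ t, IsGreatest {s : ℝ | 0 < s ∧ Module.End.HasEigenvalue (Matrix.toLin' A) s} t := by
  obtain ⟨s, hs1, hs⟩ := exists_eigenvalue_ge_of_growth hA one_pos one_pos (by simpa using hgrow)
  have hfin : {s : ℝ | 0 < s ∧ Module.End.HasEigenvalue (Matrix.toLin' A) s}.Finite :=
    (Module.End.finite_hasEigenvalue (Matrix.toLin' A)).subset fun s hs => hs.2
  obtain ⟨t, ht, hmax⟩ := Set.exists_max_image _ id hfin ⟨s, by linarith, hs⟩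
  exact ⟨t, ht, fun u hu => hmax u hu⟩

/-- The largest positive eigenvalue of a nonnegative matrix is monotone in the growth of the
powers. -/
theorem eigenvalue_le_of_growth_le {κ : Type*} [Fintype κ] [DecidableEq κ]
    {A : Matrix ι ι ℝ} {B : Matrix κ κ ℝ} (hA : ∀ i j, 0 ≤ A i j) (hB : ∀ i j, 0 ≤ B i j)
    {c : ℝ} (hc : 0 < c) (hAB : ∀ k : ℕ, ∑ i, ∑ j, (A ^ k) i j ≤ c * ∑ i, ∑ j, (B ^ k) i j)
    {r t : ℝ} (hr : 0 < r ∧ Module.End.HasEigenvalue (Matrix.toLin' A) r)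
    (ht : IsGreatest {s : ℝ | 0 < s ∧ Module.End.HasEigenvalue (Matrix.toLin' B) s} t) :
    r ≤ t := by
  obtain ⟨a, ha, hgrow⟩ := pow_le_growth_of_hasEigenvalue hA hr.1 hr.2
  obtain ⟨s, hrs, hs⟩ := exists_eigenvalue_ge_of_growth hB hr.1 (div_pos ha hc) fun k => by
    rw [div_mul_eq_mul_div, div_le_iff₀ hc, mul_comm _ c]
    exact (hgrow k).trans (hAB k)
  exact hrs.trans (ht.2 ⟨hr.1.trans_le hrs, hs⟩)

end NonnegativeMatrices

/-! ### Numbers of nonzero coefficients of powers -/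

lemma sum_range_mul_eq {M : Type*} [AddCommMonoid M] (a b : ℕ) (F : ℕ → M) :
    ∑ n ∈ Finset.range (a * b), F n =
      ∑ i ∈ Finset.range a, ∑ j ∈ Finset.range b, F (b * i + j) := by
  induction a with
  | zero => simp
  | succ a ih => rw [Nat.succ_mul, Finset.sum_range_add, ih, Finset.sum_range_succ, mul_comm b a]

section Support

variable {R : Type*} [CommRing R]

lemma card_support_expand {q : ℕ} (hq : 0 < q) (f : R[X]) :
    (expand R q f).support.card = f.support.card := by
  have h : (expand R q f).support = f.support.image (· * q) := by
    ext n
    simp only [mem_support_iff, Finset.mem_image, coeff_expand hq]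
    constructor
    · intro hn
      split_ifs at hn with hd
      · exact ⟨n / q, hn, Nat.div_mul_cancel hd⟩
      · exact absurd rfl hn
    · rintro ⟨m, hm, rfl⟩
      rwa [if_pos (dvd_mul_left q m), Nat.mul_div_cancel m hq]
  rw [h, Finset.card_image_of_injective _ fun a b hab => Nat.eq_of_mul_eq_mul_right hq hab]

lemma card_support_X_pow_mul (n : ℕ) (f : R[X]) :
    (X ^ n * f).support.card = f.support.card := by
  have h : (X ^ n * f).support = f.support.image (· + n) := by
    ext m
    simp only [mem_support_iff, Finset.mem_image, coeff_X_pow_mul']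
    constructor
    · intro hm
      split_ifs at hm with hd
      · exact ⟨m - n, hm, Nat.sub_add_cancel hd⟩
      · exact absurd rfl hm
    · rintro ⟨m, hm, rfl⟩
      rwa [if_pos (Nat.le_add_left n m), Nat.add_sub_cancel]
  rw [h, Finset.card_image_of_injective _ (add_left_injective n)]

lemma card_support_reverse (f : R[X]) : f.reverse.support.card = f.support.card := by
  rw [reverse, reflect_support, Finset.card_image_of_injective _ (revAt _).injective]

lemma card_support_C_mul [NoZeroDivisors R] {c : R} (hc : c ≠ 0) (f : R[X]) :
    (C c * f).support.card = f.support.card := by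
  congr 1
  ext n
  simp [hc]

lemma card_support_comp_C_mul_X [NoZeroDivisors R] {c : R} (hc : c ≠ 0) (f : R[X]) :
    (f.comp (C c * X)).support.card = f.support.card := by
  congr 1
  ext n
  simp only [mem_support_iff, comp_C_mul_X_coeff, ne_eq, mul_eq_zero, not_or]
  exact ⟨fun h => h.1, fun h => ⟨h, fun h' => hc (eq_zero_of_pow_eq_zero h')⟩⟩

lemma reverse_pow_of_domain [NoZeroDivisors R] [Nontrivial R] (f : R[X]) (n : ℕ) :
    (f ^ n).reverse = f.reverse ^ n := by
  induction n with
  | zero => rw [pow_zero, pow_zero, ← C_1, reverse_C]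
  | succ n ih => rw [pow_succ, reverse_mul_of_domain, ih, pow_succ]

/-- The total number of nonzero coefficients of `f ^ 0, …, f ^ (m - 1)`. -/
noncomputable def powSupportCount (f : R[X]) (m : ℕ) : ℕ := ∑ j ∈ Finset.range m, (f ^ j).support.card

/-- The nonzero coefficients of the powers `f ^ n` are controlled by those of the powers of `f ^ c`:
multiply `f ^ (c * (n / c))` by one of finitely many powers `f ^ r` with `r < c`. -/
lemma powSupportCount_le_mul_powSupportCount_pow (f : R[X]) {c : ℕ} (hc : 0 < c) (m : ℕ) :
    powSupportCount f m ≤ powSupportCount f c * powSupportCount (f ^ c) m := by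
  calc powSupportCount f m ≤ ∑ n ∈ Finset.range (m * c), (f ^ n).support.card :=
        Finset.sum_le_sum_of_subset (Finset.range_subset_range.mpr (Nat.le_mul_of_pos_right m hc))
    _ = ∑ i ∈ Finset.range m, ∑ r ∈ Finset.range c, (f ^ (c * i + r)).support.card :=
        sum_range_mul_eq m c _
    _ ≤ ∑ i ∈ Finset.range m, ∑ r ∈ Finset.range c,
          (f ^ r).support.card * ((f ^ c) ^ i).support.card := by
        refine Finset.sum_le_sum fun i _ => Finset.sum_le_sum fun r _ => ?_
        rw [add_comm, pow_add, pow_mul]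
        exact card_support_mul_le
    _ = powSupportCount f c * powSupportCount (f ^ c) m := by
        rw [mul_comm, powSupportCount, powSupportCount, Finset.sum_mul]
        refine Finset.sum_congr rfl fun i _ => ?_
        rw [Finset.mul_sum]
        exact Finset.sum_congr rfl fun r _ => mul_comm _ _

end Support

section Similar

variable {p : ℕ} [Fact p.Prime]

lemma pow_prime_pow_eq_expand (f : (ZMod p)[X]) (k : ℕ) :
    f ^ p ^ k = expand (ZMod p) (p ^ k) f := by
  induction k with
  | zero => simp
  | succ k ih => rw [pow_succ, pow_mul, ih, ← ZMod.expand_card, expand_expand, mul_comm]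

/-- The nonzero coefficients of the powers of `f ^ c` are controlled by those of the powers of `f`:
the Frobenius identity `f ^ q = f(x ^ q)` keeps the number of nonzero coefficients of
`f ^ (q * i + r)` below a constant multiple of that of `f ^ r` when `i < c`. -/
lemma powSupportCount_pow_le_mul_powSupportCount (f : (ZMod p)[X]) {c : ℕ} (hc : 0 < c) (k : ℕ) :
    powSupportCount (f ^ c) (p ^ k) ≤ powSupportCount f c * powSupportCount f (p ^ k) := by
  calc powSupportCount (f ^ c) (p ^ k)
      ≤ ∑ i ∈ Finset.range (p ^ k), ∑ r ∈ Finset.range c, (f ^ (c * i + r)).support.card := by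
        refine Finset.sum_le_sum fun i _ => ?_
        rw [← pow_mul]
        exact Finset.single_le_sum (f := fun r => (f ^ (c * i + r)).support.card)
          (fun r _ => Nat.zero_le _) (Finset.mem_range.mpr hc)
    _ = ∑ i ∈ Finset.range c, ∑ r ∈ Finset.range (p ^ k), (f ^ (p ^ k * i + r)).support.card := by
        rw [← sum_range_mul_eq (p ^ k) c fun n => (f ^ n).support.card, mul_comm,
          sum_range_mul_eq]
    _ ≤ ∑ i ∈ Finset.range c, ∑ r ∈ Finset.range (p ^ k),
          (f ^ i).support.card * (f ^ r).support.card := by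
        refine Finset.sum_le_sum fun i _ => Finset.sum_le_sum fun r _ => ?_
        rw [pow_add, mul_comm (p ^ k) i, pow_mul, pow_prime_pow_eq_expand]
        refine card_support_mul_le.trans (le_of_eq ?_)
        rw [card_support_expand (pow_pos (Fact.out : p.Prime).pos k)]
    _ = powSupportCount f c * powSupportCount f (p ^ k) := by
        rw [powSupportCount, powSupportCount, Finset.sum_mul_sum]

/-- `f` and `g` have the same numbers of nonzero coefficients in their first `p ^ k` powers, up to
constant factors. -/
def SupportCountComparable (f g : (ZMod p)[X]) : Prop :=
  (∃ c : ℕ, ∀ k, powSupportCount f (p ^ k) ≤ c * powSupportCount g (p ^ k)) ∧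
    ∃ c : ℕ, ∀ k, powSupportCount g (p ^ k) ≤ c * powSupportCount f (p ^ k)

lemma SupportCountComparable.of_eq {f g : (ZMod p)[X]}
    (h : ∀ j, (g ^ j).support.card = (f ^ j).support.card) : SupportCountComparable f g := by
  have : ∀ m, powSupportCount g m = powSupportCount f m :=
    fun m => Finset.sum_congr rfl fun j _ => h j
  exact ⟨⟨1, fun k => by rw [this, one_mul]⟩, ⟨1, fun k => by rw [this, one_mul]⟩⟩

lemma SupportCountComparable.of_step {f g : (ZMod p)[X]} (h : SimilarStep p f g) :
    SupportCountComparable f g := by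
  have hcast : ∀ c : ℕ, 1 < c → c < p → (c : ZMod p) ≠ 0 := fun c h1 hp h0 =>
    absurd (Nat.le_of_dvd (by omega) ((ZMod.natCast_eq_zero_iff c p).mp h0)) (not_le.mpr hp)
  cases h with
  | scaleVar c h1 hp =>
    exact .of_eq fun j => by rw [← pow_comp, card_support_comp_C_mul_X (hcast c h1 hp)]
  | scale c h1 hp =>
    exact .of_eq fun j => by
      rw [mul_pow, ← C_pow, card_support_C_mul (pow_ne_zero j (hcast c h1 hp))]
  | shift c h0 =>
    exact .of_eq fun j => by rw [mul_pow, ← pow_mul, card_support_X_pow_mul]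
  | powVar c h1 =>
    exact .of_eq fun j => by
      rw [← pow_comp, ← expand_eq_comp_X_pow, card_support_expand (by omega)]
  | flip =>
    exact .of_eq fun j => by rw [← reverse_pow_of_domain, card_support_reverse]
  | pow c h1 =>
    exact ⟨⟨_, fun k => powSupportCount_le_mul_powSupportCount_pow f (by omega) (p ^ k)⟩,
      ⟨_, fun k => powSupportCount_pow_le_mul_powSupportCount f (by omega) k⟩⟩

lemma SupportCountComparable.of_similar {f g : (ZMod p)[X]} (h : SimilarPoly p f g) :
    SupportCountComparable f g := by
  have htrans : ∀ {a b c : ℕ → ℕ}, (∃ m : ℕ, ∀ k, a k ≤ m * b k) → (∃ m : ℕ, ∀ k, b k ≤ m * c k) →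
      ∃ m : ℕ, ∀ k, a k ≤ m * c k := by
    rintro a b c ⟨m, hm⟩ ⟨n, hn⟩
    refine ⟨m * n, fun k => (hm k).trans ?_⟩
    rw [mul_assoc]
    exact Nat.mul_le_mul_left m (hn k)
  induction h with
  | rel f g h => exact .of_step h
  | refl f => exact .of_eq fun j => rfl
  | symm f g _ ih => exact ⟨ih.2, ih.1⟩
  | trans f g h _ _ ih1 ih2 => exact ⟨htrans ih1.1 ih2.1, htrans ih2.2 ih1.2⟩

end Similar

/-! ### Words in the block maps -/

section Blocks

variable {p : ℕ}

lemma blockPoly_add {d : ℕ} (u v : Fin d → ZMod p) :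
    blockPoly (u + v) = blockPoly u + blockPoly v := by
  simp only [blockPoly, Pi.add_apply, C_add, add_mul, Finset.sum_add_distrib]

lemma blockPoly_single {d : ℕ} (s : Fin d) (c : ZMod p) :
    blockPoly (Pi.single s c) = C c * X ^ (s : ℕ) := by
  rw [blockPoly, Finset.sum_eq_single s]
  · rw [Pi.single_eq_same]
  · intro t _ ht
    rw [Pi.single_eq_of_ne ht, C_0, zero_mul]
  · exact fun h => absurd (Finset.mem_univ s) h

/-- The block map with `q` in place of `p`: the coefficients at `jd, …, jd + d - 1` of
`x ^ i f ^ j h(x ^ q)`. For `q = p ^ k` these maps are the words of length `k` in the block maps. -/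
noncomputable def iteratedBlockMap (f : (ZMod p)[X]) (q j i : ℕ) (h : Fin f.natDegree → ZMod p) :
    Fin f.natDegree → ZMod p :=
  fun s => (X ^ i * f ^ j * expand (ZMod p) q (blockPoly h)).coeff (j * f.natDegree + s)

lemma iteratedBlockMap_prime (f : (ZMod p)[X]) (j i : ℕ) (h : Fin f.natDegree → ZMod p) :
    iteratedBlockMap f p j i h = blockMap f j i h := rfl

lemma iteratedBlockMap_zero (f : (ZMod p)[X]) (q j i : ℕ) : iteratedBlockMap f q j i 0 = 0 := by
  funext s
  simp [iteratedBlockMap, blockPoly]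

/-- A coefficient of `P F(x ^ q)` at `q a + n` depends only on the coefficients of `F` in the window
`a, …, a + d - 1`, provided that `deg P < q + n` and `n < q d`. -/
lemma coeff_mul_expand_window {d q n : ℕ} (a : ℕ) (P F : (ZMod p)[X])
    (hP : P.natDegree < q + n) (hn : n < q * d) :
    (P * expand (ZMod p) q F).coeff (q * a + n) =
      (P * expand (ZMod p) q (blockPoly fun t : Fin d => F.coeff (a + t))).coeff n := by
  induction F using Polynomial.induction_on' with
  | add F G hF hG =>
    have h : (fun t : Fin d => (F + G).coeff (a + t)) =
        (fun t : Fin d => F.coeff (a + t)) + fun t : Fin d => G.coeff (a + t) := by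
      funext t
      simp
    rw [h, blockPoly_add, map_add, map_add, mul_add, mul_add, coeff_add, coeff_add, hF, hG]
  | monomial t c =>
    by_cases hwin : a ≤ t ∧ t < a + d
    · obtain ⟨u, rfl⟩ := Nat.exists_eq_add_of_le hwin.1
      have h : (fun s : Fin d => (monomial (a + u) c).coeff (a + s)) =
          Pi.single (⟨u, by omega⟩ : Fin d) c := by
        funext s
        simp only [coeff_monomial, Pi.single_apply, Fin.ext_iff, add_right_inj, eq_comm]
      rw [h, blockPoly_single, C_mul_X_pow_eq_monomial, expand_monomial, expand_monomial,
        ← C_mul_X_pow_eq_monomial, ← C_mul_X_pow_eq_monomial, add_mul, pow_add,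
        mul_comm (X ^ (a * q)), ← mul_assoc, ← mul_assoc, add_comm (q * a), mul_comm q a,
        coeff_mul_X_pow, ← mul_assoc]
    · have h : (fun s : Fin d => (monomial t c).coeff (a + s)) = 0 := by
        funext s
        rw [coeff_monomial, if_neg (by omega), Pi.zero_apply]
      have h0 : (blockPoly (0 : Fin d → ZMod p)) = 0 := by simp [blockPoly]
      rw [h, h0, map_zero, mul_zero, coeff_zero, expand_monomial, ← C_mul_X_pow_eq_monomial,
        ← mul_assoc, coeff_mul_X_pow']
      split_ifs with hle
      · rw [mul_comm P, coeff_C_mul, coeff_eq_zero_of_natDegree_lt, mul_zero]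
        have htd : t < a := by
          by_contra hta
          have h1 : (a + d) * q ≤ t * q := Nat.mul_le_mul_right q (by omega)
          nlinarith
        have h2 : (t + 1) * q ≤ a * q := Nat.mul_le_mul_right q htd
        have h3 : (t + 1) * q = t * q + q := by ring
        have h4 : q * a = a * q := mul_comm _ _
        omega
      · rfl

variable [Fact p.Prime]

/-- Composition of iterated block maps concatenates the base-`p` digits of their indices. -/
lemma iteratedBlockMap_comp (f : (ZMod p)[X]) (k q j i : ℕ) {j' i' : ℕ} (hj : j' < p ^ k)
    (hi : i' < p ^ k) (h : Fin f.natDegree → ZMod p) :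
    iteratedBlockMap f (p ^ k) j' i' (iteratedBlockMap f q j i h) =
      iteratedBlockMap f (p ^ k * q) (p ^ k * j + j') (p ^ k * i + i') h := by
  funext s
  have hs := s.2
  have hn : j' * f.natDegree + s < p ^ k * f.natDegree := by
    have : (j' + 1) * f.natDegree ≤ p ^ k * f.natDegree := Nat.mul_le_mul_right f.natDegree hj
    rw [add_mul, one_mul] at this
    omega
  have hP : (X ^ i' * f ^ j' : (ZMod p)[X]).natDegree < p ^ k + (j' * f.natDegree + s) := by
    have h1 : (X ^ i' * f ^ j' : (ZMod p)[X]).natDegree ≤ i' + j' * f.natDegree :=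
      natDegree_mul_le.trans (add_le_add (natDegree_X_pow_le i') natDegree_pow_le)
    omega
  have hwin := coeff_mul_expand_window (j * f.natDegree) (X ^ i' * f ^ j')
    (X ^ i * f ^ j * expand (ZMod p) q (blockPoly h)) hP hn
  have hpoly : X ^ i' * f ^ j' *
        expand (ZMod p) (p ^ k) (X ^ i * f ^ j * expand (ZMod p) q (blockPoly h)) =
      X ^ (p ^ k * i + i') * f ^ (p ^ k * j + j') *
        expand (ZMod p) (p ^ k * q) (blockPoly h) := by
    rw [map_mul, map_mul, expand_expand, map_pow, map_pow, expand_X, ← pow_prime_pow_eq_expand,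
      pow_add, pow_add, pow_mul, pow_mul]
    ring
  have hidx : p ^ k * (j * f.natDegree) + (j' * f.natDegree + s) = (p ^ k * j + j') * f.natDegree + s := by ring
  rw [hpoly, hidx] at hwin
  simp only [iteratedBlockMap]
  exact hwin.symm

/-- The number of pairs `j, i < q` whose iterated block map does not annihilate `h`. -/
noncomputable def nonzeroWordCount (f : (ZMod p)[X]) (q : ℕ) (h : Fin f.natDegree → ZMod p) : ℕ :=
  ∑ j ∈ Finset.range q, ∑ i ∈ Finset.range q, if iteratedBlockMap f q j i h ≠ 0 then 1 else 0

lemma sum_nonzeroWordCount_blockMap (f : (ZMod p)[X]) (k : ℕ) (h : Fin f.natDegree → ZMod p) :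
    ∑ j : Fin p, ∑ i : Fin p, nonzeroWordCount f (p ^ k) (blockMap f j i h) =
      nonzeroWordCount f (p ^ (k + 1)) h := by
  rw [Fin.sum_univ_eq_sum_range
    (fun j => ∑ i : Fin p, nonzeroWordCount f (p ^ k) (blockMap f j i h)) p]
  rw [nonzeroWordCount, pow_succ', sum_range_mul_eq]
  refine Finset.sum_congr rfl fun j _ => ?_
  rw [Fin.sum_univ_eq_sum_range
    (fun i => nonzeroWordCount f (p ^ k) (blockMap f j i h)) p]
  simp only [nonzeroWordCount]
  rw [Finset.sum_comm]
  refine Finset.sum_congr rfl fun j' hj' => ?_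
  rw [sum_range_mul_eq]
  refine Finset.sum_congr rfl fun i _ => Finset.sum_congr rfl fun i' hi' => ?_
  rw [← iteratedBlockMap_prime, iteratedBlockMap_comp f k p j i (Finset.mem_range.mp hj')
    (Finset.mem_range.mp hi'), mul_comm (p ^ k) p]

/-- The column sums of the powers of Willson's matrix count the nonvanishing words. -/
lemma sum_willsonMatrix_pow (f : (ZMod p)[X]) (k : ℕ) (h : Block p f.natDegree) :
    ∑ h', (willsonMatrix f ^ k) h' h = nonzeroWordCount f (p ^ k) h.1 := by
  induction k generalizing h with
  | zero =>
    have h0 : iteratedBlockMap f 1 0 0 h.1 = h.1 := by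
      funext s
      simp only [iteratedBlockMap, pow_zero, one_mul, expand_one, zero_mul, zero_add, blockPoly,
        finsetSum_coeff, coeff_C_mul_X_pow]
      rw [Finset.sum_eq_single s]
      · simp
      · exact fun t _ ht => if_neg fun hst => ht (Fin.ext hst.symm)
      · exact fun hs => absurd (Finset.mem_univ s) hs
    simp [nonzeroWordCount, h0, h.2, Matrix.one_apply]
  | succ k ih =>
    have hpt : ∀ v : Fin f.natDegree → ZMod p,
        ∑ h'' : Block p f.natDegree, nonzeroWordCount f (p ^ k) h''.1 * (if v = h''.1 then 1 else 0)
          = nonzeroWordCount f (p ^ k) v := by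
      intro v
      by_cases hv : v = 0
      · subst hv
        rw [Finset.sum_eq_zero]
        · simp [nonzeroWordCount, iteratedBlockMap_zero]
        · intro h'' _
          rw [if_neg (Ne.symm h''.2), mul_zero]
      · rw [Finset.sum_eq_single ⟨v, hv⟩]
        · rw [if_pos rfl, mul_one]
        · intro h'' _ hne
          rw [if_neg fun heq => hne (Subtype.ext heq.symm), mul_zero]
        · exact fun hmem => absurd (Finset.mem_univ _) hmem
    calc ∑ h', (willsonMatrix f ^ (k + 1)) h' h
        = ∑ h'', (∑ h', (willsonMatrix f ^ k) h' h'') * willsonMatrix f h'' h := by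
          simp only [pow_succ, Matrix.mul_apply, Finset.sum_mul]
          exact Finset.sum_comm
      _ = ∑ j : Fin p, ∑ i : Fin p, nonzeroWordCount f (p ^ k) (blockMap f j i h.1) := by
          simp only [ih, willsonMatrix, Finset.mul_sum]
          rw [Finset.sum_comm]
          refine Finset.sum_congr rfl fun j _ => ?_
          rw [Finset.sum_comm]
          exact Finset.sum_congr rfl fun i _ => hpt _
      _ = nonzeroWordCount f (p ^ (k + 1)) h.1 := sum_nonzeroWordCount_blockMap f k h.1

end Blocks

/-! ### Growth of the powers of Willson's matrix -/

section Growth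

variable {p : ℕ} [Fact p.Prime]

/-- The shift `x ^ m f ^ j` has a nonzero coefficient in the window `jd, …, jd + d - 1`. -/
def HitsWindow (f : (ZMod p)[X]) (j m : ℕ) : Prop :=
  ∃ s : Fin f.natDegree, (X ^ m * f ^ j).coeff (j * f.natDegree + s) ≠ 0

lemma iteratedBlockMap_single_ne_zero (f : (ZMod p)[X]) (q j i : ℕ) (s : Fin f.natDegree) :
    iteratedBlockMap f q j i (Pi.single s 1) ≠ 0 ↔ HitsWindow f j (q * s + i) := by
  rw [Function.ne_iff, HitsWindow]
  have h : X ^ i * f ^ j * expand (ZMod p) q (blockPoly (Pi.single s 1)) =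
      X ^ (q * s + i) * f ^ j := by
    rw [blockPoly_single, C_1, one_mul, map_pow, expand_X, pow_add, ← pow_mul]
    ring
  simp only [iteratedBlockMap, h, Pi.zero_apply]

open Classical in
lemma sum_nonzeroWordCount_single (f : (ZMod p)[X]) (q : ℕ) :
    ∑ s : Fin f.natDegree, nonzeroWordCount f q (Pi.single s 1) =
      ∑ j ∈ Finset.range q,
        ((Finset.range (f.natDegree * q)).filter (HitsWindow f j)).card := by
  simp only [nonzeroWordCount]
  rw [Finset.sum_comm]
  refine Finset.sum_congr rfl fun j _ => ?_
  rw [Finset.card_filter, sum_range_mul_eq, ← Fin.sum_univ_eq_sum_range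
    (fun s => ∑ i ∈ Finset.range q, if HitsWindow f j (q * s + i) then 1 else 0)]
  refine Finset.sum_congr rfl fun s _ => Finset.sum_congr rfl fun i _ => ?_
  simp only [iteratedBlockMap_single_ne_zero]

/-- Every nonzero coefficient of `f ^ j` with `j < q` is seen by a window. -/
lemma powSupportCount_le_sum_nonzeroWordCount (f : (ZMod p)[X]) (hf : 0 < f.natDegree) (q : ℕ) :
    powSupportCount f q ≤ ∑ s : Fin f.natDegree, nonzeroWordCount f q (Pi.single s 1) := by
  classical
  rw [sum_nonzeroWordCount_single]
  refine Finset.sum_le_sum fun j hj => ?_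
  have hle : ∀ n ∈ (f ^ j).support, n ≤ j * f.natDegree := fun n hn =>
    (le_natDegree_of_mem_supp n hn).trans natDegree_pow_le
  -- The coefficient at `n` is moved to position `jd` by the shift `x ^ (jd - n)`.
  refine Finset.card_le_card_of_injOn (fun n => j * f.natDegree - n) ?_ ?_
  · intro n hn
    have hn' := hle n hn
    have hlt : j * f.natDegree < f.natDegree * q := by
      rw [mul_comm]
      exact Nat.mul_lt_mul_of_pos_left (Finset.mem_range.mp hj) hf
    simp only [Finset.coe_filter, Finset.mem_range, Set.mem_ofPred_eq]
    refine ⟨by omega, ⟨0, hf⟩, ?_⟩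
    rw [coeff_X_pow_mul', if_pos (by simp)]
    have : j * f.natDegree + 0 - (j * f.natDegree - n) = n := by omega
    simpa only [this] using mem_support_iff.mp hn
  · intro a ha b hb hab
    have h1 := hle a ha
    have h2 := hle b hb
    simp only at hab
    omega

/-- Every nonzero coefficient of `f ^ j` is seen by at most `d` windows. -/
lemma sum_nonzeroWordCount_le_powSupportCount (f : (ZMod p)[X]) (q : ℕ) :
    ∑ s : Fin f.natDegree, nonzeroWordCount f q (Pi.single s 1) ≤
      f.natDegree * powSupportCount f q := by
  classical
  rw [sum_nonzeroWordCount_single, powSupportCount, Finset.mul_sum]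
  refine Finset.sum_le_sum fun j _ => ?_
  have hsub : (Finset.range (f.natDegree * q)).filter (HitsWindow f j) ⊆
      (Finset.univ ×ˢ (f ^ j).support).image
        fun x : Fin f.natDegree × ℕ => j * f.natDegree + x.1 - x.2 := by
    intro m hm
    obtain ⟨s, hs⟩ := (Finset.mem_filter.mp hm).2
    rw [coeff_X_pow_mul'] at hs
    split_ifs at hs with hle
    · refine Finset.mem_image.mpr ⟨(s, j * f.natDegree + s - m), ?_, ?_⟩
      · exact Finset.mem_product.mpr ⟨Finset.mem_univ s, mem_support_iff.mpr hs⟩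
      · simp only
        omega
    · exact absurd rfl hs
  calc _ ≤ _ := Finset.card_le_card hsub
    _ ≤ _ := Finset.card_image_le
    _ = f.natDegree * (f ^ j).support.card := by
      rw [Finset.card_product, Finset.card_univ, Fintype.card_fin]

lemma nonzeroWordCount_le_sum_single (f : (ZMod p)[X]) (q : ℕ) (h : Fin f.natDegree → ZMod p) :
    nonzeroWordCount f q h ≤
      ∑ s : Fin f.natDegree, nonzeroWordCount f q (Pi.single s 1) := by
  have hcomm : ∑ s : Fin f.natDegree, nonzeroWordCount f q (Pi.single s 1) =
      ∑ j ∈ Finset.range q, ∑ i ∈ Finset.range q, ∑ s : Fin f.natDegree,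
        if iteratedBlockMap f q j i (Pi.single s 1) ≠ 0 then 1 else 0 :=
    Finset.sum_comm.trans (Finset.sum_congr rfl fun j _ => Finset.sum_comm)
  rw [hcomm, nonzeroWordCount]
  refine Finset.sum_le_sum fun j _ => Finset.sum_le_sum fun i _ => ?_
  split_ifs with hne
  · -- By linearity, a word not annihilating `h` does not annihilate some unit block.
    by_contra! hlt
    have hzero : ∀ s : Fin f.natDegree, iteratedBlockMap f q j i (Pi.single s 1) = 0 := by
      intro s
      have := (Finset.sum_eq_zero_iff (M := ℕ)).mp (Nat.lt_one_iff.mp hlt) s (Finset.mem_univ s)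
      by_contra hs
      rw [if_pos hs] at this
      exact one_ne_zero this
    refine hne (funext fun t => ?_)
    have hexp : X ^ i * f ^ j * expand (ZMod p) q (blockPoly h) =
        ∑ s, C (h s) * (X ^ i * f ^ j * expand (ZMod p) q (blockPoly (Pi.single s 1))) := by
      simp only [blockPoly_single, C_1, one_mul]
      rw [blockPoly, map_sum, Finset.mul_sum]
      refine Finset.sum_congr rfl fun s _ => ?_
      rw [map_mul, expand_C]
      ring
    rw [iteratedBlockMap, hexp, finsetSum_coeff, Pi.zero_apply]
    refine Finset.sum_eq_zero fun s _ => ?_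
    rw [coeff_C_mul]
    have := congrFun (hzero s) t
    rw [iteratedBlockMap, Pi.zero_apply] at this
    rw [this, mul_zero]
  · exact Nat.zero_le _

lemma sum_sum_willsonMatrix_pow (f : (ZMod p)[X]) (k : ℕ) :
    ∑ h', ∑ h, (willsonMatrix f ^ k) h' h =
      ∑ h : Block p f.natDegree, nonzeroWordCount f (p ^ k) h.1 :=
  Finset.sum_comm.trans (Finset.sum_congr rfl fun h _ => sum_willsonMatrix_pow f k h)

lemma sum_willsonMatrix_pow_le (f : (ZMod p)[X]) (k : ℕ) :
    ∑ h', ∑ h, (willsonMatrix f ^ k) h' h ≤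
      Fintype.card (Block p f.natDegree) * f.natDegree * powSupportCount f (p ^ k) := by
  rw [sum_sum_willsonMatrix_pow, mul_assoc]
  calc ∑ h : Block p f.natDegree, nonzeroWordCount f (p ^ k) h.1
      ≤ ∑ _h : Block p f.natDegree, f.natDegree * powSupportCount f (p ^ k) :=
        Finset.sum_le_sum fun h _ => (nonzeroWordCount_le_sum_single f _ h.1).trans
          (sum_nonzeroWordCount_le_powSupportCount f _)
    _ = _ := by rw [Finset.sum_const, Finset.card_univ, smul_eq_mul]

lemma powSupportCount_le_sum_willsonMatrix_pow (f : (ZMod p)[X]) (hf : 0 < f.natDegree) (k : ℕ) :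
    powSupportCount f (p ^ k) ≤ f.natDegree * ∑ h', ∑ h, (willsonMatrix f ^ k) h' h := by
  refine (powSupportCount_le_sum_nonzeroWordCount f hf _).trans ?_
  rw [sum_sum_willsonMatrix_pow]
  have hle : ∀ h : Block p f.natDegree, nonzeroWordCount f (p ^ k) h.1 ≤
      ∑ h : Block p f.natDegree, nonzeroWordCount f (p ^ k) h.1 := fun h =>
    Finset.single_le_sum (f := fun h : Block p f.natDegree => nonzeroWordCount f (p ^ k) h.1)
      (fun _ _ => Nat.zero_le _) (Finset.mem_univ h)
  have hne : ∀ s : Fin f.natDegree, (Pi.single s 1 : Fin f.natDegree → ZMod p) ≠ 0 :=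
    fun s => Pi.single_ne_zero_iff.mpr one_ne_zero
  refine (Finset.sum_le_card_nsmul _ _ _ fun s _ => hle ⟨Pi.single s 1, hne s⟩).trans ?_
  rw [Finset.card_univ, Fintype.card_fin, smul_eq_mul]

lemma sum_map_willsonMatrix_pow (f : (ZMod p)[X]) (k : ℕ) :
    ∑ h', ∑ h, ((willsonMatrix f).map (Nat.cast : ℕ → ℝ) ^ k) h' h =
      ((∑ h', ∑ h, (willsonMatrix f ^ k) h' h : ℕ) : ℝ) := by
  rw [matrix_map_natCast_pow]
  simp only [Matrix.map_apply, Nat.cast_sum]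

lemma map_willsonMatrix_nonneg (f : (ZMod p)[X]) (h' h : Block p f.natDegree) :
    0 ≤ (willsonMatrix f).map (Nat.cast : ℕ → ℝ) h' h :=
  Nat.cast_nonneg _

lemma exists_isPerronFrobeniusEigenvalue (f : (ZMod p)[X]) (hf : 0 < f.natDegree) :
    ∃ t, IsPerronFrobeniusEigenvalue f t := by
  refine exists_isGreatest_pos_eigenvalue (map_willsonMatrix_nonneg f) fun k => ?_
  rw [sum_map_willsonMatrix_pow]
  have hpos : 0 < powSupportCount f (p ^ k) := by
    refine lt_of_lt_of_le ?_ (Finset.single_le_sum (f := fun j => (f ^ j).support.card)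
      (fun _ _ => Nat.zero_le _) (Finset.mem_range.mpr (pow_pos (Fact.out : p.Prime).pos k)))
    rw [pow_zero, Finset.card_pos]
    exact nonempty_support_iff.mpr one_ne_zero
  have hle := powSupportCount_le_sum_willsonMatrix_pow f hf k
  exact_mod_cast Nat.pos_of_mul_pos_left (hpos.trans_le hle)

lemma perronFrobeniusEigenvalue_le {f g : (ZMod p)[X]} (hg : 0 < g.natDegree) {c : ℕ}
    (hc : ∀ k, powSupportCount f (p ^ k) ≤ c * powSupportCount g (p ^ k)) {r t : ℝ}
    (hr : IsPerronFrobeniusEigenvalue f r) (ht : IsPerronFrobeniusEigenvalue g t) : r ≤ t := by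
  -- Adding one makes the constant positive.
  refine eigenvalue_le_of_growth_le (map_willsonMatrix_nonneg f) (map_willsonMatrix_nonneg g)
    (c := ((Fintype.card (Block p f.natDegree) * f.natDegree * (c * g.natDegree) + 1 : ℕ) : ℝ))
    (Nat.cast_pos.mpr (Nat.succ_pos _)) (fun k => ?_) hr.1 ht
  rw [sum_map_willsonMatrix_pow, sum_map_willsonMatrix_pow, ← Nat.cast_mul, Nat.cast_le]
  set K := Fintype.card (Block p f.natDegree) * f.natDegree
  calc ∑ h', ∑ h, (willsonMatrix f ^ k) h' h ≤ K * powSupportCount f (p ^ k) :=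
        sum_willsonMatrix_pow_le f k
    _ ≤ K * (c * (g.natDegree * ∑ h', ∑ h, (willsonMatrix g ^ k) h' h)) := by
        gcongr
        refine (hc k).trans ?_
        gcongr
        exact powSupportCount_le_sum_willsonMatrix_pow g hg k
    _ = K * (c * g.natDegree) * ∑ h', ∑ h, (willsonMatrix g ^ k) h' h := by ring
    _ ≤ _ := Nat.mul_le_mul_right _ (Nat.le_succ _)

end Growth

theorem mainTheorem7 (p : ℕ) [Fact p.Prime] (f g : (ZMod p)[X])
    (hf : 0 < f.natDegree) (hg : 0 < g.natDegree) (hfg : SimilarPoly p f g) :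
    ∃ t : ℝ, IsPerronFrobeniusEigenvalue f t ∧ IsPerronFrobeniusEigenvalue g t := by
  obtain ⟨r, hr⟩ := exists_isPerronFrobeniusEigenvalue f hf
  obtain ⟨t, ht⟩ := exists_isPerronFrobeniusEigenvalue g hg
  obtain ⟨⟨a, ha⟩, ⟨b, hb⟩⟩ := SupportCountComparable.of_similar hfg
  have hrt : r = t := le_antisymm (perronFrobeniusEigenvalue_le hg ha hr ht)
    (perronFrobeniusEigenvalue_le hf hb ht hr)
  exact ⟨r, hr, hrt ▸ ht⟩
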